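/- For an open set $D\subset\mathbb R^n$ and $1\le p\le\infty$ let $L^1_p(D)$ be the space of locally summable, weakly differentiable functions $f:D\to\mathbb R$ with finite seminorm $\|f\mid L^1_p(D)\|=\|\,|\nabla f|\,\mid L_p(D)\|$, where $\nabla f$ is the weak gradient. Functions in $L^1_p(D)$ are always modified on a set of measure zero so that $f(x)=\lim_{r\to0}\frac1{|B(x,r)|}\int_{B(x,r)}f\,dy$ at every point $x\in D$ where this limit exists (for $p=\infty$ this is the continuous representative). A mapping $\varphi:D\to\mathbb R^n$ belongs to $L^1_p(D)$ if its coordinate functions do. A mapping $\varphi:D\to D'$ generates a bounded composition operator $\varphi^*:L^1_p(D')\to L^1_q(D)$, $\varphi^*f=f\circ\varphi$, if there is a constant $K<\infty$ such that for every $f\in L^1_p(D')$ one has $f\circ\varphi\in L^1_q(D)$ and $\|f\circ\varphi\mid L^1_q(D)\|\le K\,\|f\mid L^1_p(D')\|$. Theorem 2. Let $D,D'\subset\mathbb R^n$ be domains (non-empty, open, connected), let $\varphi:D\to D'$ be a homeomorphism of $D$ onto $D'$, and let $1<q<\infty$. Then $\varphi$ generates a bounded composition operator $$\varphi^*:L^1_\infty(D')\to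 L^1_q(D)$$ if and only if $\varphi$ belongs to the Sobolev space $L^1_q(D)$. -/

import Mathlib

open MeasureTheory Filter Topology
open scoped ENNReal NNReal ContDiff

/-- `g` is a weak gradient of the locally summable function `f` on the open set `D`: `g` is locally
summable on `D` and `∫_D f ∂η/∂xᵢ = - ∫_D gᵢ η` for every `i` and every `η ∈ C₀^∞(D)`.
Functions on `D` are total functions whose values outside `D` play no role. -/
structure HasWeakGradient {n : ℕ} (D : Set (EuclideanSpace ℝ (Fin n)))
    (f : EuclideanSpace ℝ (Fin n) → ℝ)
    (g : EuclideanSpace ℝ (Fin n) → EuclideanSpace ℝ (Fin n)) : Prop where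
  locallyIntegrableOn : LocallyIntegrableOn f D
  locallyIntegrableOn_grad : LocallyIntegrableOn g D
  integral_eq : ∀ η : EuclideanSpace ℝ (Fin n) → ℝ,
    ContDiff ℝ ∞ η → HasCompactSupport η → tsupport η ⊆ D → ∀ i : Fin n,
      ∫ x in D, f x * fderiv ℝ η x (EuclideanSpace.single i 1) = - ∫ x in D, g x i * η x

/-- `f` is locally summable and weakly differentiable on `D`. -/
def WeaklyDifferentiable {n : ℕ} (D : Set (EuclideanSpace ℝ (Fin n)))
    (f : EuclideanSpace ℝ (Fin n) → ℝ) : Prop :=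
  ∃ g, HasWeakGradient D f g

open Classical in
/-- The weak gradient `∇f` of `f` on `D`, determined up to a null subset of `D` (see
`HasWeakGradient.ae_eq`); it is `0` if `f` is not weakly differentiable. -/
noncomputable def weakGradient {n : ℕ} (D : Set (EuclideanSpace ℝ (Fin n)))
    (f : EuclideanSpace ℝ (Fin n) → ℝ) :
    EuclideanSpace ℝ (Fin n) → EuclideanSpace ℝ (Fin n) :=
  if h : WeaklyDifferentiable D f then h.choose else 0

/-- The seminorm `‖f | L¹_p(D)‖ = ‖ |∇f| | L_p(D)‖`, with the Euclidean norm of the gradient. -/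
noncomputable def sobolevSeminorm {n : ℕ} (p : ℝ≥0∞) (D : Set (EuclideanSpace ℝ (Fin n)))
    (f : EuclideanSpace ℝ (Fin n) → ℝ) : ℝ≥0∞ :=
  eLpNorm (weakGradient D f) p (volume.restrict D)

/-- The function `f` belongs to the Sobolev space `L¹_p(D)`. -/
def MemSobolev1 {n : ℕ} (p : ℝ≥0∞) (D : Set (EuclideanSpace ℝ (Fin n)))
    (f : EuclideanSpace ℝ (Fin n) → ℝ) : Prop :=
  WeaklyDifferentiable D f ∧ sobolevSeminorm p D f < ⊤

/-- The mapping `φ` belongs to `L¹_p(D)`: all its coordinate functions do. -/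
def MapMemSobolev1 {n : ℕ} (p : ℝ≥0∞) (D : Set (EuclideanSpace ℝ (Fin n)))
    (φ : EuclideanSpace ℝ (Fin n) → EuclideanSpace ℝ (Fin n)) : Prop :=
  ∀ j : Fin n, MemSobolev1 p D (fun x => φ x j)

/-- `c` is the Lebesgue value of `f` at `x`: the limit of the mean values of `f` over the balls
`B(x, r)` as `r → 0`. -/
def IsLebesgueValue {n : ℕ} (f : EuclideanSpace ℝ (Fin n) → ℝ) (x : EuclideanSpace ℝ (Fin n))
    (c : ℝ) : Prop :=
  Tendsto (fun r : ℝ => ⨍ y in Metric.ball x r, f y) (𝓝[>] 0) (𝓝 c)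

open Classical in
/-- The modified function: `f` changed to its Lebesgue value at every point where this exists. -/
noncomputable def lebesgueModification {n : ℕ} (f : EuclideanSpace ℝ (Fin n) → ℝ) :
    EuclideanSpace ℝ (Fin n) → ℝ :=
  fun x => if h : ∃ c, IsLebesgueValue f x c then h.choose else f x

/-- `φ : D → D'` generates a bounded composition operator `φ* : L¹_p(D') → L¹_q(D)`. Elements of
`L¹_p(D')`, which are determined almost everywhere only, are composed with `φ` through their
modified functions (a homeomorphism may map a set of positive measure to a null set). -/
def GeneratesBoundedComposition {n : ℕ} (p q : ℝ≥0∞) (D D' : Set (EuclideanSpace ℝ (Fin n)))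
    (φ : EuclideanSpace ℝ (Fin n) → EuclideanSpace ℝ (Fin n)) : Prop :=
  ∃ K : ℝ≥0, ∀ f : EuclideanSpace ℝ (Fin n) → ℝ, MemSobolev1 p D' f →
    MemSobolev1 q D (lebesgueModification f ∘ φ) ∧
      sobolevSeminorm q D (lebesgueModification f ∘ φ) ≤ K * sobolevSeminorm p D' f

/-- The weak gradient is unique up to a null set. -/
theorem HasWeakGradient.ae_eq {n : ℕ} {D : Set (EuclideanSpace ℝ (Fin n))} (hD : IsOpen D)
    {f : EuclideanSpace ℝ (Fin n) → ℝ}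
    {g h : EuclideanSpace ℝ (Fin n) → EuclideanSpace ℝ (Fin n)}
    (hg : HasWeakGradient D f g) (hh : HasWeakGradient D f h) :
    g =ᵐ[volume.restrict D] h := by
  have coord : ∀ {u : EuclideanSpace ℝ (Fin n) → EuclideanSpace ℝ (Fin n)},
      LocallyIntegrableOn u D → ∀ i : Fin n, LocallyIntegrableOn (fun x => u x i) D := by
    intro u hu i x hx
    obtain ⟨t, ht, hi⟩ := hu x hx
    exact ⟨t, ht, (EuclideanSpace.proj (𝕜 := ℝ) i).integrable_comp hi⟩
  have key : ∀ i : Fin n, ∀ᵐ x ∂(volume.restrict D), g x i = h x i := by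
    intro i
    have hgi := coord hg.locallyIntegrableOn_grad i
    have hhi := coord hh.locallyIntegrableOn_grad i
    rw [ae_restrict_iff' hD.measurableSet]
    have := hD.ae_eq_zero_of_integral_contDiff_smul_eq_zero (μ := volume)
      (f := fun x => g x i - h x i) (hgi.sub hhi) (by
        intro η hη hc hs
        have e := (hg.integral_eq η hη hc hs i).symm.trans (hh.integral_eq η hη hc hs i)
        have aux : ∀ {v : EuclideanSpace ℝ (Fin n) → ℝ}, LocallyIntegrableOn v D →
            Integrable (fun x => v x * η x) (volume.restrict D) := by
          intro v hv
          have h1 : IntegrableOn v (tsupport η) := hv.integrableOn_compact_subset hs hc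
          have h2 : IntegrableOn (fun x => v x * η x) (tsupport η) :=
            h1.mul_continuousOn hη.continuous.continuousOn hc
          refine Integrable.integrableOn ?_
          refine (integrableOn_iff_integrable_of_support_subset ?_).1 h2
          intro x hx
          exact subset_tsupport _ (fun h0 => hx (by simp [h0]))
        have e2 : ∫ x in D, η x • (g x i - h x i) = 0 := by
          have : ∀ x, η x • (g x i - h x i) = g x i * η x - h x i * η x := by
            intro x; simp only [smul_eq_mul]; ring
          simp only [this]
          rw [integral_sub (aux hgi) (aux hhi)]
          linarith
        rw [← e2, setIntegral_eq_integral_of_forall_compl_eq_zero]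
        intro x hx
        rw [image_eq_zero_of_notMem_tsupport (fun hx' => hx (hs hx')), zero_smul])
    filter_upwards [this] with x hx hxD
    exact sub_eq_zero.1 (hx hxD)
  filter_upwards [ae_all_iff.2 key] with x hx
  ext i
  exact hx i

open Metric Set
open scoped Convolution

variable {n : ℕ}

/-! Necessity: the coordinate functions of `D'` have constant unit gradients and are continuous, so
they lie in `L¹_∞(D')` and equal their modifications; composing them with `φ` returns the
coordinates of `φ`.

Sufficiency: let `|∇f| ≤ M` a.e. The modification `F` of `f` is locally Lipschitz on `D'`. A
pointwise chain rule for `F ∘ φ` is unavailable, since `F` is differentiable only a.e. and `φ` may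
send a set of positive measure into the exceptional null set. The proof works with distributions
instead: `|∫ (F ∘ φ) ∂ᵢη| ≤ M ∑ⱼ ∫ |∇φⱼ| |η|` for every test function `η`. For mollified `F` and
mollified `φ` this is the classical chain rule and integration by parts. The limit is taken first in
the map, then in `F` (`norm_integral_comp_mul_fderiv_le_of_contDiff`,
`HasWeakGradient.norm_integral_comp_mul_fderiv_le`).

The derivatives of `F ∘ φ` are thus functionals dominated by the function `G = M ∑ⱼ |∇φⱼ|` of `L_q`.
Hahn–Banach and Riesz in a weighted `L²` represent them by functions bounded by `G`
(`exists_integral_representation`). These form the weak gradient of `F ∘ φ`, of norm at most `n G`.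
-/

/-! ### Mollification and weak derivatives. -/

/-- The mollification of `g` by the normed bump function `ρ`. -/
noncomputable def mollify (ρ : ContDiffBump (0 : EuclideanSpace ℝ (Fin n)))
    (g : EuclideanSpace ℝ (Fin n) → ℝ) : EuclideanSpace ℝ (Fin n) → ℝ :=
  ρ.normed volume ⋆[ContinuousLinearMap.lsmul ℝ ℝ, volume] g

theorem mollify_apply (ρ : ContDiffBump (0 : EuclideanSpace ℝ (Fin n)))
    (g : EuclideanSpace ℝ (Fin n) → ℝ) (x : EuclideanSpace ℝ (Fin n)) :
    mollify ρ g x = ∫ t, ρ.normed volume (x - t) * g t := by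
  simp [mollify, convolution_eq_swap]

theorem contDiff_mollify (ρ : ContDiffBump (0 : EuclideanSpace ℝ (Fin n)))
    {g : EuclideanSpace ℝ (Fin n) → ℝ} (hg : LocallyIntegrable g) :
    ContDiff ℝ ∞ (mollify ρ g) :=
  ρ.hasCompactSupport_normed.contDiff_convolution_left _ ρ.contDiff_normed hg

theorem integrable_bump_mul (ρ : ContDiffBump (0 : EuclideanSpace ℝ (Fin n)))
    {g : EuclideanSpace ℝ (Fin n) → ℝ} (hg : LocallyIntegrable g)
    (x : EuclideanSpace ℝ (Fin n)) :
    Integrable (fun t => ρ.normed volume (x - t) * g t) := by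
  have h := (ρ.hasCompactSupport_normed (μ := volume)).convolutionExists_left
    (ContinuousLinearMap.lsmul ℝ ℝ) ρ.continuous_normed hg x
  simpa using h.integrable_swap

theorem fderiv_mollify_apply (ρ : ContDiffBump (0 : EuclideanSpace ℝ (Fin n)))
    {g : EuclideanSpace ℝ (Fin n) → ℝ} (hg : LocallyIntegrable g)
    (x v : EuclideanSpace ℝ (Fin n)) :
    fderiv ℝ (mollify ρ g) x v = ∫ t, g t * fderiv ℝ (ρ.normed volume) (x - t) v := by
  have hc := ρ.hasCompactSupport_normed (μ := volume)
  have h1 : ContDiff ℝ 1 (ρ.normed (volume : Measure (EuclideanSpace ℝ (Fin n)))) :=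
    ρ.contDiff_normed
  have h := hc.hasFDerivAt_convolution_left (ContinuousLinearMap.lsmul ℝ ℝ) h1 hg x
  have hex := (hc.fderiv (𝕜 := ℝ)).convolutionExists_left
    ((ContinuousLinearMap.lsmul ℝ ℝ).precompL (EuclideanSpace ℝ (Fin n)))
    (h1.continuous_fderiv one_ne_zero) hg x
  rw [mollify, h.fderiv, convolution_def, ContinuousLinearMap.integral_apply hex.integrable,
    ← integral_sub_left_eq_self _ volume x]
  congr 1
  ext t
  simp [ContinuousLinearMap.precompL_apply, mul_comm]

theorem locallyIntegrableOn_coord {D : Set (EuclideanSpace ℝ (Fin n))}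
    {u : EuclideanSpace ℝ (Fin n) → EuclideanSpace ℝ (Fin n)}
    (hu : LocallyIntegrableOn u D) (i : Fin n) : LocallyIntegrableOn (fun x => u x i) D := by
  intro x hx
  obtain ⟨t, ht, hi⟩ := hu x hx
  exact ⟨t, ht, (EuclideanSpace.proj (𝕜 := ℝ) i).integrable_comp hi⟩

theorem integrable_indicator_of_isCompact {F : Type*} [NormedAddCommGroup F]
    {D C : Set (EuclideanSpace ℝ (Fin n))}
    {f : EuclideanSpace ℝ (Fin n) → F} (hf : LocallyIntegrableOn f D) (hC : IsCompact C)
    (hCD : C ⊆ D) : Integrable (C.indicator f) :=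
  (hf.integrableOn_compact_subset hCD hC).integrable_indicator hC.measurableSet

theorem contDiff_bump_sub (ρ : ContDiffBump (0 : EuclideanSpace ℝ (Fin n)))
    (x : EuclideanSpace ℝ (Fin n)) : ContDiff ℝ ∞ fun t => ρ.normed volume (x - t) :=
  ContDiff.comp (g := ρ.normed volume) ρ.contDiff_normed (contDiff_const.sub contDiff_id)

theorem tsupport_bump_sub_subset (ρ : ContDiffBump (0 : EuclideanSpace ℝ (Fin n)))
    (x : EuclideanSpace ℝ (Fin n)) :
    tsupport (fun t => ρ.normed volume (x - t)) ⊆ closedBall x ρ.rOut := by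
  refine closure_minimal ?_ isClosed_closedBall
  intro t ht
  have : x - t ∈ Function.support (ρ.normed volume) := ht
  rw [ρ.support_normed_eq] at this
  rw [mem_closedBall, dist_comm, dist_eq_norm]
  exact (mem_ball_zero_iff.1 this).le

theorem hasCompactSupport_bump_sub (ρ : ContDiffBump (0 : EuclideanSpace ℝ (Fin n)))
    (x : EuclideanSpace ℝ (Fin n)) : HasCompactSupport fun t => ρ.normed volume (x - t) :=
  (isCompact_closedBall x ρ.rOut).of_isClosed_subset (isClosed_tsupport _)
    (tsupport_bump_sub_subset ρ x)

/-- Cutting off by `C` makes a function that is only locally summable on `D` globally integrable.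
The cut is invisible at `x` because the kernel centred there is supported in `C`. -/
theorem mollify_indicator_eq_setIntegral {D C : Set (EuclideanSpace ℝ (Fin n))} (hD : IsOpen D)
    (hCD : C ⊆ D) (ρ : ContDiffBump (0 : EuclideanSpace ℝ (Fin n)))
    {x : EuclideanSpace ℝ (Fin n)} (hx : closedBall x ρ.rOut ⊆ C)
    (p : EuclideanSpace ℝ (Fin n) → ℝ) :
    mollify ρ (C.indicator p) x = ∫ t in D, p t * ρ.normed volume (x - t) := by
  rw [mollify_apply, ← integral_indicator hD.measurableSet]
  congr 1
  ext t
  by_cases ht : t ∈ C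
  · simp [ht, hCD ht, mul_comm]
  · have h0 : ρ.normed volume (x - t) = 0 := image_eq_zero_of_notMem_tsupport
      (f := fun t => ρ.normed volume (x - t)) fun h' => ht (hx (tsupport_bump_sub_subset ρ x h'))
    by_cases htD : t ∈ D <;> simp [ht, htD, h0]

/-- Mollification commutes with weak differentiation. -/
theorem HasWeakGradient.fderiv_mollify_single {D C : Set (EuclideanSpace ℝ (Fin n))}
    {f : EuclideanSpace ℝ (Fin n) → ℝ} {g : EuclideanSpace ℝ (Fin n) → EuclideanSpace ℝ (Fin n)}
    (h : HasWeakGradient D f g) (hD : IsOpen D) (hC : IsCompact C) (hCD : C ⊆ D)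
    (ρ : ContDiffBump (0 : EuclideanSpace ℝ (Fin n))) {x : EuclideanSpace ℝ (Fin n)}
    (hx : closedBall x ρ.rOut ⊆ C) (i : Fin n) :
    fderiv ℝ (mollify ρ (C.indicator f)) x (EuclideanSpace.single i 1) =
      mollify ρ (C.indicator fun y => g y i) x := by
  have hf := (integrable_indicator_of_isCompact h.locallyIntegrableOn hC hCD)
  rw [fderiv_mollify_apply ρ hf.locallyIntegrable,
    mollify_indicator_eq_setIntegral hD hCD ρ hx]
  set η : EuclideanSpace ℝ (Fin n) → ℝ := fun t => ρ.normed volume (x - t)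
  have hρ : ContDiff ℝ ∞ (ρ.normed (volume : Measure (EuclideanSpace ℝ (Fin n)))) :=
    ρ.contDiff_normed
  have hηs : tsupport η ⊆ closedBall x ρ.rOut := tsupport_bump_sub_subset ρ x
  have hd : ∀ t, fderiv ℝ η t (EuclideanSpace.single i 1) =
      - fderiv ℝ (ρ.normed volume) (x - t) (EuclideanSpace.single i 1) := by
    intro t
    have h1 : HasFDerivAt (fun t => x - t)
        (-ContinuousLinearMap.id ℝ (EuclideanSpace ℝ (Fin n))) t :=
      (hasFDerivAt_id t).const_sub x
    have h2 := ((hρ.differentiable (by simp)) (x - t)).hasFDerivAt.comp t h1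
    rw [show η = ρ.normed volume ∘ (fun t => x - t) from rfl, h2.fderiv]
    simp
  -- Differentiating the kernel in `t` instead of `x` changes the sign, which cancels the minus sign
  -- in the definition of the weak gradient.
  have key := h.integral_eq η (contDiff_bump_sub ρ x) (hasCompactSupport_bump_sub ρ x)
     (hηs.trans (hx.trans hCD)) i
  have e1 : ∫ t, C.indicator f t * fderiv ℝ (ρ.normed volume) (x - t)
      (EuclideanSpace.single i 1) = - ∫ t in D, f t * fderiv ℝ η t (EuclideanSpace.single i 1) := by
    rw [← integral_neg, ← integral_indicator hD.measurableSet]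
    congr 1
    ext t
    by_cases ht : t ∈ C
    · simp [ht, hCD ht, hd]
    · have h0 : fderiv ℝ η t = 0 :=
        fderiv_of_notMem_tsupport ℝ (fun h' => ht (hx (hηs h')))
      have h0' : fderiv ℝ (ρ.normed volume) (x - t) (EuclideanSpace.single i 1) = 0 := by
        have := hd t
        rw [h0] at this
        simpa using this
      by_cases htD : t ∈ D <;> simp [ht, htD, h0, h0']
  rw [e1, key, neg_neg]

theorem integral_bump_sub (ρ : ContDiffBump (0 : EuclideanSpace ℝ (Fin n)))
    (x : EuclideanSpace ℝ (Fin n)) : ∫ t, ρ.normed volume (x - t) = 1 := by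
  rw [integral_sub_left_eq_self (fun t => ρ.normed volume t) volume x, ρ.integral_normed]

/-- The derivative in a direction `v` is the mean of `⟨v, g⟩` under a probability kernel. Estimating
all directions at once keeps the Euclidean bound `M` free of a dimensional factor. -/
theorem HasWeakGradient.norm_fderiv_mollify_le {D C : Set (EuclideanSpace ℝ (Fin n))}
    {f : EuclideanSpace ℝ (Fin n) → ℝ} {g : EuclideanSpace ℝ (Fin n) → EuclideanSpace ℝ (Fin n)}
    (h : HasWeakGradient D f g) (hD : IsOpen D) (hC : IsCompact C) (hCD : C ⊆ D)
    (ρ : ContDiffBump (0 : EuclideanSpace ℝ (Fin n))) {x : EuclideanSpace ℝ (Fin n)}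
    (hx : closedBall x ρ.rOut ⊆ C) {M : ℝ} (hM : 0 ≤ M)
    (hgM : ∀ᵐ y ∂(volume.restrict D), ‖g y‖ ≤ M) :
    ‖fderiv ℝ (mollify ρ (C.indicator f)) x‖ ≤ M := by
  refine ContinuousLinearMap.opNorm_le_bound _ hM fun v => ?_
  have hgi : ∀ i, Integrable (C.indicator fun y => g y i) := fun i =>
    integrable_indicator_of_isCompact
      (locallyIntegrableOn_coord h.locallyIntegrableOn_grad i) hC hCD
  have hv : v = ∑ i, v i • EuclideanSpace.single i (1 : ℝ) := by
    ext j
    simp [Finset.sum_apply, Pi.single_apply]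
  have e : fderiv ℝ (mollify ρ (C.indicator f)) x v =
      ∫ t, ρ.normed volume (x - t) * inner ℝ v (C.indicator g t) := by
    conv_lhs => rw [hv]
    rw [map_sum]
    simp_rw [map_smul, h.fderiv_mollify_single hD hC hCD ρ hx, mollify_apply, smul_eq_mul,
      ← integral_const_mul]
    rw [← integral_finsetSum _ fun i _ =>
      (integrable_bump_mul ρ (hgi i).locallyIntegrable x).const_mul _]
    congr 1
    ext t
    by_cases ht : t ∈ C
    · simp only [ht, indicator_of_mem, PiLp.inner_apply, Finset.mul_sum]
      refine Finset.sum_congr rfl fun i _ => ?_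
      simp
      ring
    · simp [ht]
  rw [e]
  have hgC : ∀ᵐ y, ‖C.indicator g y‖ ≤ M := by
    filter_upwards [(ae_restrict_iff' hD.measurableSet).1 hgM] with y hy
    by_cases hyC : y ∈ C
    · simpa [hyC] using hy (hCD hyC)
    · simpa [hyC] using hM
  have hint : Integrable (fun t => ρ.normed volume (x - t)) :=
    ρ.integrable_normed.comp_sub_left x
  calc ‖∫ t, ρ.normed volume (x - t) * inner ℝ v (C.indicator g t)‖
      ≤ ∫ t, ρ.normed volume (x - t) * (M * ‖v‖) := by
        refine norm_integral_le_of_norm_le (hint.mul_const _) ?_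
        filter_upwards [hgC] with t ht
        rw [norm_mul, Real.norm_of_nonneg (ρ.nonneg_normed _)]
        refine mul_le_mul_of_nonneg_left ((norm_inner_le_norm _ _).trans ?_) (ρ.nonneg_normed _)
        rw [mul_comm]
        exact mul_le_mul_of_nonneg_right ht (norm_nonneg _)
    _ = M * ‖v‖ := by rw [integral_mul_const, integral_bump_sub, one_mul]

/-! ### A shrinking sequence of kernels. -/

/-- A sequence of bump functions with radii tending to zero. -/
noncomputable def bumpSeq (n k : ℕ) : ContDiffBump (0 : EuclideanSpace ℝ (Fin n)) where
  rIn := 1 / ((k : ℝ) + 1) / 2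
  rOut := 1 / ((k : ℝ) + 1)
  rIn_pos := by positivity
  rIn_lt_rOut := half_lt_self (by positivity)

theorem tendsto_bumpSeq_rOut (n : ℕ) :
    Tendsto (fun k => (bumpSeq n k).rOut) atTop (𝓝 0) :=
  tendsto_one_div_add_atTop_nhds_zero_nat

theorem eventually_bumpSeq_rOut_lt (n : ℕ) {r : ℝ} (hr : 0 < r) :
    ∀ᶠ k in atTop, (bumpSeq n k).rOut < r :=
  (tendsto_bumpSeq_rOut n).eventually_lt_const hr

/-- The ratio of outer to inner radius stays equal to 2, so the kernels are controlled by normalized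
indicators of balls and Lebesgue differentiation applies. -/
theorem ae_tendsto_mollify {g : EuclideanSpace ℝ (Fin n) → ℝ} (hg : LocallyIntegrable g) :
    ∀ᵐ x, Tendsto (fun k => mollify (bumpSeq n k) g x) atTop (𝓝 (g x)) :=
  ContDiffBump.ae_convolution_tendsto_right_of_locallyIntegrable (K := 2)
    (tendsto_bumpSeq_rOut n) (Eventually.of_forall fun k => by simp [bumpSeq]; linarith) hg

/-! ### Modification on null sets and the locally Lipschitz representative. -/

theorem locallyIntegrableOn_congr_ae {F : Type*} [NormedAddCommGroup F]
    {D : Set (EuclideanSpace ℝ (Fin n))}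
    {f f' : EuclideanSpace ℝ (Fin n) → F} (hf : LocallyIntegrableOn f D)
    (hff : f =ᵐ[volume.restrict D] f') : LocallyIntegrableOn f' D := by
  intro x hx
  obtain ⟨t, ht, hi⟩ := hf x hx
  refine ⟨t ∩ D, inter_mem ht self_mem_nhdsWithin, ?_⟩
  exact (hi.mono_set inter_subset_left).congr_fun_ae
    (ae_mono (Measure.restrict_mono inter_subset_right le_rfl) hff)

theorem HasWeakGradient.congr_ae {D : Set (EuclideanSpace ℝ (Fin n))}
    {f f' : EuclideanSpace ℝ (Fin n) → ℝ}
    {g : EuclideanSpace ℝ (Fin n) → EuclideanSpace ℝ (Fin n)}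
    (h : HasWeakGradient D f g) (hff : f =ᵐ[volume.restrict D] f') : HasWeakGradient D f' g where
  locallyIntegrableOn := locallyIntegrableOn_congr_ae h.locallyIntegrableOn hff
  locallyIntegrableOn_grad := h.locallyIntegrableOn_grad
  integral_eq η h1 h2 h3 i := by
    rw [← h.integral_eq η h1 h2 h3 i]
    refine integral_congr_ae ?_
    filter_upwards [hff] with x hx
    rw [hx]

theorem tendsto_average_ball {F : EuclideanSpace ℝ (Fin n) → ℝ} (hF : Continuous F)
    (x : EuclideanSpace ℝ (Fin n)) :
    Tendsto (fun r : ℝ => ⨍ y in ball x r, F y) (𝓝[>] 0) (𝓝 (F x)) := by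
  rw [Metric.tendsto_nhds]
  intro ε hε
  obtain ⟨δ, hδ, h⟩ := Metric.continuous_iff.1 hF x (ε / 2) (by positivity)
  filter_upwards [Ioo_mem_nhdsGT hδ] with r hr
  have : (⨍ y in ball x r, F y) ∈ closedBall (F x) (ε / 2) := by
    refine (convex_closedBall _ _).set_average_mem isClosed_closedBall
      (measure_ball_pos _ _ hr.1).ne' measure_ball_lt_top.ne ?_ ?_
    · filter_upwards [ae_restrict_mem measurableSet_ball] with y hy
      exact (h y ((mem_ball.1 hy).trans hr.2)).le
    · exact (hF.continuousOn.integrableOn_compact (isCompact_closedBall x r)).mono_set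
        ball_subset_closedBall
  exact lt_of_le_of_lt (mem_closedBall.1 this) (by linarith)

theorem IsLebesgueValue.lebesgueModification_eq {f : EuclideanSpace ℝ (Fin n) → ℝ}
    {x : EuclideanSpace ℝ (Fin n)} {c : ℝ} (h : IsLebesgueValue f x c) :
    lebesgueModification f x = c := by
  have hex : ∃ c, IsLebesgueValue f x c := ⟨c, h⟩
  rw [lebesgueModification, dif_pos hex]
  exact tendsto_nhds_unique hex.choose_spec h

/-- Means over small balls do not see null sets, and those of a continuous function converge to its
value. -/
theorem lebesgueModification_eq_of_ae_eq {U : Set (EuclideanSpace ℝ (Fin n))} (hU : IsOpen U)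
    {f F : EuclideanSpace ℝ (Fin n) → ℝ} (hF : Continuous F)
    (h : f =ᵐ[volume.restrict U] F) {x : EuclideanSpace ℝ (Fin n)} (hx : x ∈ U) :
    lebesgueModification f x = F x := by
  refine IsLebesgueValue.lebesgueModification_eq ((tendsto_average_ball hF x).congr' ?_)
  obtain ⟨δ, hδ, hb⟩ := Metric.isOpen_iff.1 hU x hx
  filter_upwards [Ioo_mem_nhdsGT hδ] with r hr
  refine average_congr ?_
  exact EventuallyEq.symm
    (ae_mono (Measure.restrict_mono ((ball_subset_ball hr.2.le).trans hb) le_rfl) h)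

theorem lebesgueModification_of_continuous {f : EuclideanSpace ℝ (Fin n) → ℝ}
    (hf : Continuous f) : lebesgueModification f = f := by
  ext x
  exact lebesgueModification_eq_of_ae_eq isOpen_univ hf (ae_eq_refl f) (mem_univ x)

/-- A function with bounded weak gradient locally agrees a.e. with a Lipschitz function. -/
theorem HasWeakGradient.exists_lipschitzWith {D : Set (EuclideanSpace ℝ (Fin n))}
    {f : EuclideanSpace ℝ (Fin n) → ℝ} {g : EuclideanSpace ℝ (Fin n) → EuclideanSpace ℝ (Fin n)}
    (h : HasWeakGradient D f g) (hD : IsOpen D) {M : ℝ≥0}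
    (hgM : ∀ᵐ y ∂(volume.restrict D), ‖g y‖ ≤ M) {x₀ : EuclideanSpace ℝ (Fin n)} (hx₀ : x₀ ∈ D) :
    ∃ r > 0, ∃ F : EuclideanSpace ℝ (Fin n) → ℝ, LipschitzWith M F ∧
      f =ᵐ[volume.restrict (ball x₀ r)] F := by
  obtain ⟨R, hR, hRD⟩ := Metric.nhds_basis_closedBall.mem_iff.1 (hD.mem_nhds hx₀)
  set C := closedBall x₀ R
  have hC : IsCompact C := isCompact_closedBall _ _
  have hf1 := integrable_indicator_of_isCompact h.locallyIntegrableOn hC hRD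
  -- On the convex half ball the mollifications are `M`-Lipschitz once their radius is below `R /
  -- 2`. The bound passes to `f` on the set `A` of convergence, which has full measure there;
  -- extending from `A` with the same constant gives `F`.
  set A := {x ∈ ball x₀ (R / 2) |
    Tendsto (fun k => mollify (bumpSeq n k) (C.indicator f) x) atTop (𝓝 (C.indicator f x))}
  have hAC : A ⊆ C := fun x hx =>
    ball_subset_closedBall (ball_subset_ball (half_le_self hR.le) hx.1)
  have hlip : LipschitzOnWith M f A := by
    refine LipschitzOnWith.of_dist_le_mul fun x hx y hy => ?_
    have h1 := (hx.2.dist hy.2)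
    rw [indicator_of_mem (hAC hx), indicator_of_mem (hAC hy)] at h1
    refine le_of_tendsto h1 ?_
    filter_upwards [eventually_bumpSeq_rOut_lt n (half_pos hR)] with k hk
    have hl : LipschitzOnWith M (mollify (bumpSeq n k) (C.indicator f)) (ball x₀ (R / 2)) := by
      refine (convex_ball x₀ (R / 2)).lipschitzOnWith_of_nnnorm_fderiv_le (𝕜 := ℝ) ?_ ?_
      · intro z _
        exact ((contDiff_mollify _ hf1.locallyIntegrable).differentiable (by simp)) z
      · intro z hz
        refine h.norm_fderiv_mollify_le hD hC hRD _ ?_ M.2 hgM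
        refine closedBall_subset_closedBall' ?_
        have := mem_ball.1 hz
        linarith
    exact hl.dist_le_mul x hx.1 y hy.1
  obtain ⟨F, hF, hfF⟩ := hlip.extend_real
  refine ⟨R / 2, half_pos hR, F, hF, ?_⟩
  filter_upwards [ae_restrict_mem measurableSet_ball,
    ae_restrict_of_ae (ae_tendsto_mollify hf1.locallyIntegrable)] with x hx hx'
  exact hfF ⟨hx, hx'⟩

theorem HasWeakGradient.continuousOn_lebesgueModification {D : Set (EuclideanSpace ℝ (Fin n))}
    {f : EuclideanSpace ℝ (Fin n) → ℝ} {g : EuclideanSpace ℝ (Fin n) → EuclideanSpace ℝ (Fin n)}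
    (h : HasWeakGradient D f g) (hD : IsOpen D) {M : ℝ≥0}
    (hgM : ∀ᵐ y ∂(volume.restrict D), ‖g y‖ ≤ M) : ContinuousOn (lebesgueModification f) D := by
  intro x hx
  obtain ⟨r, hr, F, hF, hfF⟩ := h.exists_lipschitzWith hD hgM hx
  refine (hF.continuous.continuousAt.congr ?_).continuousWithinAt
  filter_upwards [ball_mem_nhds x hr] with y hy
  exact (lebesgueModification_eq_of_ae_eq isOpen_ball hF.continuous hfF hy).symm

theorem HasWeakGradient.ae_eq_lebesgueModification {D : Set (EuclideanSpace ℝ (Fin n))}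
    {f : EuclideanSpace ℝ (Fin n) → ℝ} {g : EuclideanSpace ℝ (Fin n) → EuclideanSpace ℝ (Fin n)}
    (h : HasWeakGradient D f g) (hD : IsOpen D) {M : ℝ≥0}
    (hgM : ∀ᵐ y ∂(volume.restrict D), ‖g y‖ ≤ M) :
    f =ᵐ[volume.restrict D] lebesgueModification f := by
  rw [EventuallyEq, ae_restrict_iff' hD.measurableSet, ae_iff]
  -- A set that is null near each of its points is null, so the local representatives need not be
  -- glued.
  refine measure_null_of_locally_null _ fun x hx => ?_
  simp only [mem_ofPred_eq, Classical.not_imp] at hx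
  obtain ⟨r, hr, F, hF, hfF⟩ := h.exists_lipschitzWith hD hgM hx.1
  refine ⟨_, inter_mem_nhdsWithin _ (ball_mem_nhds x hr), ?_⟩
  have h0 := (ae_restrict_iff' measurableSet_ball).1 hfF
  rw [ae_iff] at h0
  refine measure_mono_null (fun y hy => ?_) h0
  simp only [mem_ofPred_eq, Classical.not_imp, mem_inter_iff] at hy ⊢
  refine ⟨hy.2, ?_⟩
  rw [← lebesgueModification_eq_of_ae_eq isOpen_ball hF.continuous hfF hy.2]
  exact hy.1.2

/-! ### Duality and limits of mollified integrals. -/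

theorem norm_mollify_le (ρ : ContDiffBump (0 : EuclideanSpace ℝ (Fin n)))
    {p : EuclideanSpace ℝ (Fin n) → ℝ} {B : ℝ} (hp : ∀ x, ‖p x‖ ≤ B)
    (x : EuclideanSpace ℝ (Fin n)) : ‖mollify ρ p x‖ ≤ B := by
  rw [mollify_apply]
  calc ‖∫ t, ρ.normed volume (x - t) * p t‖ ≤ ∫ t, ρ.normed volume (x - t) * B := by
        refine norm_integral_le_of_norm_le ((ρ.integrable_normed.comp_sub_left x).mul_const _) ?_
        refine Eventually.of_forall fun t => ?_
        rw [norm_mul, Real.norm_of_nonneg (ρ.nonneg_normed _)]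
        exact mul_le_mul_of_nonneg_left (hp t) (ρ.nonneg_normed _)
    _ = B := by rw [integral_mul_const, integral_bump_sub, one_mul]

/-- Fubini and the evenness of the kernel make mollification self-adjoint. -/
theorem integral_mollify_mul (ρ : ContDiffBump (0 : EuclideanSpace ℝ (Fin n)))
    {p ψ : EuclideanSpace ℝ (Fin n) → ℝ} (hp : Integrable p) (hψ : Integrable ψ) :
    ∫ x, mollify ρ p x * ψ x = ∫ x, p x * mollify ρ ψ x := by
  simp_rw [mollify_apply, ← integral_mul_const, ← integral_const_mul]
  have hc : Continuous fun z : EuclideanSpace ℝ (Fin n) × EuclideanSpace ℝ (Fin n) =>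
      ρ.normed volume (z.1 - z.2) := ρ.continuous_normed.comp (continuous_fst.sub continuous_snd)
  obtain ⟨B, hB⟩ := (ρ.hasCompactSupport_normed (μ := volume)).exists_bound_of_continuous
    ρ.continuous_normed
  have hint : Integrable (fun z : EuclideanSpace ℝ (Fin n) × EuclideanSpace ℝ (Fin n) =>
      ρ.normed volume (z.1 - z.2) * (ψ z.1 * p z.2)) (volume.prod volume) :=
    (hψ.mul_prod hp).bdd_mul hc.aestronglyMeasurable (Eventually.of_forall fun z => hB _)
  rw [integral_integral_swap]
  · refine integral_congr_ae (Eventually.of_forall fun t => ?_)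
    refine integral_congr_ae (Eventually.of_forall fun x => ?_)
    have : ρ.normed volume (x - t) = ρ.normed volume (t - x) := by
      rw [← ρ.normed_neg, neg_sub]
    simp only [this]
    ring
  · refine hint.congr (Eventually.of_forall fun z => ?_)
    simp only [Function.uncurry]
    ring

theorem tendsto_mollify_of_continuousAt {p : EuclideanSpace ℝ (Fin n) → ℝ}
    (hp : AEStronglyMeasurable p) {x : EuclideanSpace ℝ (Fin n)} (hx : ContinuousAt p x) :
    Tendsto (fun k => mollify (bumpSeq n k) p x) atTop (𝓝 (p x)) :=
  ContDiffBump.convolution_tendsto_right (tendsto_bumpSeq_rOut n)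
    (Eventually.of_forall fun _ => hp) (hx.tendsto.comp tendsto_snd) tendsto_const_nhds

/-- Moving the mollification onto the continuous factor `ψ` gives pointwise convergence with the
majorant `B |p|`. -/
theorem tendsto_integral_mollify_mul {p ψ : EuclideanSpace ℝ (Fin n) → ℝ} (hp : Integrable p)
    (hψ : Continuous ψ) (hψc : HasCompactSupport ψ) :
    Tendsto (fun k => ∫ x, mollify (bumpSeq n k) p x * ψ x) atTop (𝓝 (∫ x, p x * ψ x)) := by
  have hψi := hψ.integrable_of_hasCompactSupport (μ := volume) hψc
  simp_rw [integral_mollify_mul _ hp hψi]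
  obtain ⟨B, hB⟩ := hψc.exists_bound_of_continuous hψ
  refine tendsto_integral_of_dominated_convergence (fun x => ‖p x‖ * B) ?_ (hp.norm.mul_const _)
    ?_ ?_
  · intro k
    exact hp.aestronglyMeasurable.mul
      (contDiff_mollify _ hψi.locallyIntegrable).continuous.aestronglyMeasurable
  · intro k
    refine Eventually.of_forall fun x => ?_
    rw [norm_mul]
    exact mul_le_mul_of_nonneg_left (norm_mollify_le _ hB x) (norm_nonneg _)
  · refine Eventually.of_forall fun x => ?_
    exact (tendsto_mollify_of_continuousAt hψ.aestronglyMeasurable hψ.continuousAt).const_mul _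

theorem EuclideanSpace.norm_le_sum_norm (v : EuclideanSpace ℝ (Fin n)) :
    ‖v‖ ≤ ∑ i, ‖v i‖ := by
  have hv : v = ∑ i, v i • EuclideanSpace.single i (1 : ℝ) := by
    ext j
    simp [Finset.sum_apply, Pi.single_apply]
  conv_lhs => rw [hv]
  refine (norm_sum_le _ _).trans_eq ?_
  simp [norm_smul]

theorem norm_mollify_le_mollify (ρ : ContDiffBump (0 : EuclideanSpace ℝ (Fin n)))
    {p P : EuclideanSpace ℝ (Fin n) → ℝ} (hP : LocallyIntegrable P) (hpP : ∀ x, ‖p x‖ ≤ P x)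
    (x : EuclideanSpace ℝ (Fin n)) : ‖mollify ρ p x‖ ≤ mollify ρ P x := by
  rw [mollify_apply, mollify_apply]
  refine norm_integral_le_of_norm_le (integrable_bump_mul ρ hP x) ?_
  refine Eventually.of_forall fun t => ?_
  rw [norm_mul, Real.norm_of_nonneg (ρ.nonneg_normed _)]
  exact mul_le_mul_of_nonneg_left (hpP t) (ρ.nonneg_normed _)

/-! ### Mollified Sobolev maps. -/

/-- The coordinatewise mollification of the map `Φ`, cut off outside `C`. -/
noncomputable def mollifyMap (C : Set (EuclideanSpace ℝ (Fin n)))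
    (Φ : EuclideanSpace ℝ (Fin n) → EuclideanSpace ℝ (Fin n)) (k : ℕ) :
    EuclideanSpace ℝ (Fin n) → EuclideanSpace ℝ (Fin n) :=
  fun x => WithLp.toLp 2 fun j => mollify (bumpSeq n k) (C.indicator fun y => Φ y j) x

theorem closedBall_subset_cthickening_of_mem {K : Set (EuclideanSpace ℝ (Fin n))} {r s t : ℝ}
    (hst : r + s ≤ t) {x : EuclideanSpace ℝ (Fin n)} (hx : x ∈ thickening r K) :
    closedBall x s ⊆ cthickening t K := by
  intro y hy
  obtain ⟨z, hz, hxz⟩ := mem_thickening_iff.1 hx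
  refine mem_cthickening_of_dist_le y z _ _ hz ?_
  have := mem_closedBall.1 hy
  linarith [dist_triangle y x z]

section Map

variable {D K : Set (EuclideanSpace ℝ (Fin n))}
  {Φ : EuclideanSpace ℝ (Fin n) → EuclideanSpace ℝ (Fin n)}

theorem contDiff_mollifyMap {C : Set (EuclideanSpace ℝ (Fin n))} (hΦ : ContinuousOn Φ C)
    (hC : IsCompact C) (k : ℕ) : ContDiff ℝ ∞ (mollifyMap C Φ k) := by
  rw [contDiff_euclidean]
  intro j
  refine contDiff_mollify _ (Integrable.locallyIntegrable ?_)
  have : ContinuousOn (fun y => Φ y j) C :=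
    (EuclideanSpace.proj (𝕜 := ℝ) j).continuous.comp_continuousOn hΦ
  exact (this.integrableOn_compact hC).integrable_indicator hC.measurableSet

theorem eventually_dist_mollifyMap_lt {r : ℝ} (hr : 0 < r) (hK : IsCompact K)
    (hΦ : ContinuousOn Φ (cthickening r K)) {ε : ℝ} (hε : 0 < ε) :
    ∀ᶠ k in atTop, ∀ x ∈ K, dist (mollifyMap (cthickening r K) Φ k x) (Φ x) < ε := by
  have hC : IsCompact (cthickening r K) := hK.cthickening
  have hu := hC.uniformContinuousOn_of_continuous hΦ
  -- The `n` coordinate errors then sum to strictly less than `ε`, also when `n = 0`.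
  obtain ⟨δ, hδ, hu⟩ := Metric.uniformContinuousOn_iff.1 hu (ε / (n + 1)) (by positivity)
  filter_upwards [eventually_bumpSeq_rOut_lt n hδ, eventually_bumpSeq_rOut_lt n hr]
    with k hk hk' x hx
  have hxC : x ∈ cthickening r K := self_subset_cthickening K hx
  have hj : ∀ j, ‖(mollifyMap (cthickening r K) Φ k x - Φ x) j‖ ≤ ε / (n + 1) := by
    intro j
    have hcj : ContinuousOn (fun y => Φ y j) (cthickening r K) :=
      (EuclideanSpace.proj (𝕜 := ℝ) j).continuous.comp_continuousOn hΦ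
    have := (bumpSeq n k).dist_normed_convolution_le (μ := volume) (x₀ := x) (ε := ε / (n + 1))
      (g := (cthickening r K).indicator fun y => Φ y j)
      ((hcj.integrableOn_compact hC).integrable_indicator hC.measurableSet).aestronglyMeasurable
      (by
        intro y hy
        have hyC : y ∈ cthickening r K :=
          mem_cthickening_of_dist_le y x _ _ hx ((mem_ball.1 hy).trans hk').le
        rw [indicator_of_mem hyC, indicator_of_mem hxC]
        have h1 := hu y hyC x hxC ((mem_ball.1 hy).trans hk)
        rw [dist_eq_norm] at h1 ⊢
        exact (PiLp.norm_apply_le (Φ y - Φ x) j).trans h1.le)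
    rw [indicator_of_mem hxC, dist_eq_norm] at this
    exact this
  rw [dist_eq_norm]
  calc _ ≤ ∑ j, ‖(mollifyMap (cthickening r K) Φ k x - Φ x) j‖ :=
        EuclideanSpace.norm_le_sum_norm _
    _ ≤ ∑ j : Fin n, ε / (n + 1) := Finset.sum_le_sum fun j _ => hj j
    _ = n * (ε / (n + 1)) := by simp
    _ < ε := by
      rw [mul_div_assoc', div_lt_iff₀ (by positivity)]
      nlinarith

/-- The majorant is linear in the mollified `‖G j‖`, so its integral against `|η|` passes to the
limit. -/
theorem norm_fderiv_mollifyMap_le {C : Set (EuclideanSpace ℝ (Fin n))} (hΦ : ContinuousOn Φ C)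
    {G : Fin n → EuclideanSpace ℝ (Fin n) → EuclideanSpace ℝ (Fin n)}
    (hG : ∀ j, HasWeakGradient D (fun x => Φ x j) (G j)) (hD : IsOpen D) (hC : IsCompact C)
    (hCD : C ⊆ D) {k : ℕ} {x : EuclideanSpace ℝ (Fin n)}
    (hx : closedBall x (bumpSeq n k).rOut ⊆ C) (i : Fin n) :
    ‖fderiv ℝ (mollifyMap C Φ k) x (EuclideanSpace.single i 1)‖ ≤
      ∑ j, mollify (bumpSeq n k) (C.indicator fun y => ‖G j y‖) x := by
  refine (EuclideanSpace.norm_le_sum_norm _).trans (Finset.sum_le_sum fun j _ => ?_)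
  have hd : DifferentiableAt ℝ (mollifyMap C Φ k) x :=
    (contDiff_mollifyMap hΦ hC k).differentiable (by simp) x
  have e : (fderiv ℝ (mollifyMap C Φ k) x (EuclideanSpace.single i 1)) j =
      mollify (bumpSeq n k) (C.indicator fun y => G j y i) x := by
    rw [← (hG j).fderiv_mollify_single hD hC hCD _ hx i]
    have := ((EuclideanSpace.proj (𝕜 := ℝ) j).hasFDerivAt.comp x hd.hasFDerivAt).fderiv
    have e2 : (EuclideanSpace.proj (𝕜 := ℝ) j) ∘ mollifyMap C Φ k =
      mollify (bumpSeq n k) (C.indicator fun y => Φ y j) := rfl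
    rw [e2] at this
    rw [this]
    rfl
  rw [e]
  refine norm_mollify_le_mollify _ (Integrable.locallyIntegrable ?_) (fun y => ?_) x
  · exact IntegrableOn.integrable_indicator
      ((hG j).locallyIntegrableOn_grad.integrableOn_compact_subset hCD hC).norm hC.measurableSet
  · by_cases hy : y ∈ C
    · simpa [hy] using PiLp.norm_apply_le (G j y) i
    · simp [hy]

end Map

/-! ### Compositions tested against derivatives. -/

theorem setIntegral_mul_fderiv_eq {D : Set (EuclideanSpace ℝ (Fin n))}
    {η : EuclideanSpace ℝ (Fin n) → ℝ} (hη : tsupport η ⊆ D) (u : EuclideanSpace ℝ (Fin n) → ℝ)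
    (v : EuclideanSpace ℝ (Fin n)) :
    ∫ x in D, u x * fderiv ℝ η x v = ∫ x, u x * fderiv ℝ η x v := by
  refine setIntegral_eq_integral_of_forall_compl_eq_zero fun x hx => ?_
  rw [fderiv_of_notMem_tsupport ℝ (fun h => hx (hη h))]
  simp

theorem setIntegral_mul_eq {D : Set (EuclideanSpace ℝ (Fin n))}
    {η : EuclideanSpace ℝ (Fin n) → ℝ} (hη : tsupport η ⊆ D)
    (u : EuclideanSpace ℝ (Fin n) → ℝ) :
    ∫ x in D, u x * η x = ∫ x, u x * η x := by
  refine setIntegral_eq_integral_of_forall_compl_eq_zero fun x hx => ?_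
  rw [image_eq_zero_of_notMem_tsupport (fun h => hx (hη h)), mul_zero]

/-- The composition of a smooth function with a Sobolev map, tested against a derivative. -/
theorem norm_integral_comp_mul_fderiv_le_of_contDiff {D : Set (EuclideanSpace ℝ (Fin n))}
    (hD : IsOpen D) {Φ : EuclideanSpace ℝ (Fin n) → EuclideanSpace ℝ (Fin n)}
    (hΦ : ContinuousOn Φ D)
    {G : Fin n → EuclideanSpace ℝ (Fin n) → EuclideanSpace ℝ (Fin n)}
    (hG : ∀ j, HasWeakGradient D (fun x => Φ x j) (G j))
    {η : EuclideanSpace ℝ (Fin n) → ℝ} (hη : ContDiff ℝ ∞ η) (hηc : HasCompactSupport η)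
    (hηD : tsupport η ⊆ D) (i : Fin n) {M s : ℝ} (hM : 0 ≤ M) (hs : 0 < s)
    {H : EuclideanSpace ℝ (Fin n) → ℝ} (hH : ContDiff ℝ ∞ H)
    (hHM : ∀ y ∈ thickening s (Φ '' tsupport η), ‖fderiv ℝ H y‖ ≤ M) :
    ‖∫ x in D, H (Φ x) * fderiv ℝ η x (EuclideanSpace.single i 1)‖ ≤
      M * ∑ j, ∫ x in D, ‖G j x‖ * ‖η x‖ := by
  set K := tsupport η
  have hK : IsCompact K := hηc
  obtain ⟨r, hr, hrD⟩ := hK.exists_cthickening_subset_open hD hηD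
  set C := cthickening r K
  have hC : IsCompact C := hK.cthickening
  have hΦC : ContinuousOn Φ C := hΦ.mono hrD
  have hKC : K ⊆ C := self_subset_cthickening K
  have hev : ∀ᶠ k in atTop, ∀ x ∈ K, dist (mollifyMap C Φ k x) (Φ x) < s :=
    eventually_dist_mollifyMap_lt hr hK hΦC hs
  have hη' : Continuous fun x => fderiv ℝ η x (EuclideanSpace.single i 1) :=
    (hη.continuous_fderiv (by simp)).clm_apply continuous_const
  have hη'c : HasCompactSupport fun x => fderiv ℝ η x (EuclideanSpace.single i 1) :=
    hηc.fderiv_apply ℝ _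
  have hHk : ∀ k, ContDiff ℝ ∞ (H ∘ mollifyMap C Φ k) := fun k =>
    hH.comp (contDiff_mollifyMap hΦC hC k)
  have hGC : ∀ j, Integrable (C.indicator fun y => ‖G j y‖) := fun j =>
    IntegrableOn.integrable_indicator
      ((hG j).locallyIntegrableOn_grad.integrableOn_compact_subset hrD hC).norm hC.measurableSet
  have hlhs : Tendsto (fun k => ∫ x, H (mollifyMap C Φ k x) *
      fderiv ℝ η x (EuclideanSpace.single i 1)) atTop
      (𝓝 (∫ x in D, H (Φ x) * fderiv ℝ η x (EuclideanSpace.single i 1))) := by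
    rw [setIntegral_mul_fderiv_eq hηD]
    -- On `K` the mollified maps eventually take values in this compact neighbourhood of `Φ '' K`,
    -- where `H` is bounded; this gives the majorant.
    have hN : IsCompact (cthickening s (Φ '' K)) :=
      (hK.image_of_continuousOn (hΦC.mono hKC)).cthickening
    obtain ⟨B, hB⟩ := hN.exists_bound_of_continuousOn hH.continuous.continuousOn
    refine tendsto_integral_filter_of_dominated_convergence
      (fun x => B * ‖fderiv ℝ η x (EuclideanSpace.single i 1)‖) ?_ ?_ ?_ ?_
    · exact Eventually.of_forall fun k =>
        ((hHk k).continuous.mul hη').aestronglyMeasurable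
    · filter_upwards [hev] with k hk
      refine Eventually.of_forall fun x => ?_
      rw [norm_mul]
      by_cases hx : x ∈ K
      · refine mul_le_mul_of_nonneg_right (hB _ ?_) (norm_nonneg _)
        exact mem_cthickening_of_dist_le _ _ _ _ (mem_image_of_mem Φ hx) (hk x hx).le
      · rw [fderiv_of_notMem_tsupport ℝ hx]
        simp
    · exact (hη'.integrable_of_hasCompactSupport hη'c).norm.const_mul B
    · refine Eventually.of_forall fun x => ?_
      by_cases hx : x ∈ K
      · refine Tendsto.mul_const _ (((hH.continuous.tendsto _)).comp ?_)
        rw [Metric.tendsto_nhds]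
        intro ε hε
        exact (eventually_dist_mollifyMap_lt hr hK hΦC hε).mono fun k hk => hk x hx
      · rw [fderiv_of_notMem_tsupport ℝ hx]
        simp
  have hrhs : Tendsto (fun k => M * ∑ j, ∫ x, mollify (bumpSeq n k) (C.indicator fun y => ‖G j y‖) x
      * ‖η x‖) atTop (𝓝 (M * ∑ j, ∫ x in D, ‖G j x‖ * ‖η x‖)) := by
    refine Tendsto.const_mul _ (tendsto_finsetSum _ fun j _ => ?_)
    have h1 := tendsto_integral_mollify_mul (hGC j) hη.continuous.norm hηc.norm
    convert h1 using 2
    rw [← integral_indicator hD.measurableSet]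
    congr 1
    ext x
    by_cases hx : x ∈ C
    · simp [hx, hrD hx]
    · have h0 : η x = 0 := image_eq_zero_of_notMem_tsupport (fun h' => hx (hKC h'))
      by_cases hxD : x ∈ D <;> simp [hx, hxD, h0]
  refine le_of_tendsto_of_tendsto hlhs.norm hrhs ?_
  filter_upwards [hev, eventually_bumpSeq_rOut_lt n hr] with k hk hk'
  have hm : ContDiff ℝ ∞ (mollifyMap C Φ k) := contDiff_mollifyMap hΦC hC k
  have hD' : Continuous fun x => fderiv ℝ (H ∘ mollifyMap C Φ k) x (EuclideanSpace.single i 1) :=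
    ((hHk k).continuous_fderiv (by simp)).clm_apply continuous_const
  -- Both factors are now smooth, so classical integration by parts applies; the chain rule below
  -- bounds the derivative on `K`.
  have hparts : ∫ x, H (mollifyMap C Φ k x) * fderiv ℝ η x (EuclideanSpace.single i 1) =
      - ∫ x, fderiv ℝ (H ∘ mollifyMap C Φ k) x (EuclideanSpace.single i 1) * η x := by
    refine integral_mul_fderiv_eq_neg_fderiv_mul_of_integrable
      (f := H ∘ mollifyMap C Φ k) ?_ ?_ ?_ ?_ ?_
    · exact (hD'.mul hη.continuous).integrable_of_hasCompactSupport hηc.mul_left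
    · exact ((hHk k).continuous.mul hη').integrable_of_hasCompactSupport hη'c.mul_left
    · exact ((hHk k).continuous.mul hη.continuous).integrable_of_hasCompactSupport hηc.mul_left
    · exact fun x _ => (hHk k).differentiable (by simp) x
    · exact fun x _ => hη.differentiable (by simp) x
  rw [hparts, norm_neg]
  have hint : ∀ j, Integrable fun x =>
      mollify (bumpSeq n k) (C.indicator fun y => ‖G j y‖) x * ‖η x‖ := fun j =>
    ((contDiff_mollify _ (hGC j).locallyIntegrable).continuous.mul hη.continuous.norm)
      |>.integrable_of_hasCompactSupport hηc.norm.mul_left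
  rw [← integral_finsetSum _ fun j _ => hint j, ← integral_const_mul]
  refine norm_integral_le_of_norm_le ((integrable_finsetSum _ fun j _ => hint j).const_mul M) ?_
  refine Eventually.of_forall fun x => ?_
  by_cases hx : x ∈ K
  · have hsub : closedBall x (bumpSeq n k).rOut ⊆ C := by
      intro y hy
      exact mem_cthickening_of_dist_le y x _ _ hx ((mem_closedBall.1 hy).trans hk'.le)
    have h1 := norm_fderiv_mollifyMap_le hΦC hG hD hC hrD hsub i
    have h2 : ‖fderiv ℝ H (mollifyMap C Φ k x)‖ ≤ M :=
      hHM _ (mem_thickening_iff.2 ⟨_, mem_image_of_mem Φ hx, hk x hx⟩)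
    have h3 : fderiv ℝ (H ∘ mollifyMap C Φ k) x (EuclideanSpace.single i 1) =
        fderiv ℝ H (mollifyMap C Φ k x)
          (fderiv ℝ (mollifyMap C Φ k) x (EuclideanSpace.single i 1)) := by
      rw [fderiv_comp x (hH.differentiable (by simp) _) (hm.differentiable (by simp) x)]
      rfl
    rw [norm_mul, h3, ← Finset.sum_mul, ← mul_assoc]
    refine mul_le_mul_of_nonneg_right ?_ (norm_nonneg _)
    refine (ContinuousLinearMap.le_opNorm _ _).trans ?_
    exact mul_le_mul h2 h1 (norm_nonneg _) hM
  · have h0 : η x = 0 := image_eq_zero_of_notMem_tsupport hx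
    simp [h0]

/-- The composition of a Lipschitz function with a Sobolev map, tested against a derivative. -/
theorem HasWeakGradient.norm_integral_comp_mul_fderiv_le {D D' : Set (EuclideanSpace ℝ (Fin n))}
    (hD : IsOpen D) (hD' : IsOpen D')
    {Φ : EuclideanSpace ℝ (Fin n) → EuclideanSpace ℝ (Fin n)}
    (hΦ : ContinuousOn Φ D) (hmaps : MapsTo Φ D D')
    {G : Fin n → EuclideanSpace ℝ (Fin n) → EuclideanSpace ℝ (Fin n)}
    (hG : ∀ j, HasWeakGradient D (fun x => Φ x j) (G j))
    {f : EuclideanSpace ℝ (Fin n) → ℝ} {g : EuclideanSpace ℝ (Fin n) → EuclideanSpace ℝ (Fin n)}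
    (hf : HasWeakGradient D' f g) (hfc : ContinuousOn f D') {M : ℝ} (hM : 0 ≤ M)
    (hgM : ∀ᵐ y ∂(volume.restrict D'), ‖g y‖ ≤ M)
    {η : EuclideanSpace ℝ (Fin n) → ℝ} (hη : ContDiff ℝ ∞ η) (hηc : HasCompactSupport η)
    (hηD : tsupport η ⊆ D) (i : Fin n) :
    ‖∫ x in D, f (Φ x) * fderiv ℝ η x (EuclideanSpace.single i 1)‖ ≤
      M * ∑ j, ∫ x in D, ‖G j x‖ * ‖η x‖ := by
  have hK : IsCompact (tsupport η) := hηc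
  have hL : IsCompact (Φ '' tsupport η) := hK.image_of_continuousOn (hΦ.mono hηD)
  have hLD : Φ '' tsupport η ⊆ D' := (hmaps.mono_left hηD).image_subset
  obtain ⟨r, hr, hrD⟩ := hL.exists_cthickening_subset_open hD' hLD
  set C := cthickening r (Φ '' tsupport η)
  have hC : IsCompact C := hL.cthickening
  have hLC : Φ '' tsupport η ⊆ C := self_subset_cthickening _
  have hfC := integrable_indicator_of_isCompact hf.locallyIntegrableOn hC hrD
  obtain ⟨B, hB⟩ := hC.exists_bound_of_continuousOn (hfc.mono hrD)
  have hB' : ∀ x, ‖C.indicator f x‖ ≤ max B 0 := by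
    intro x
    by_cases hx : x ∈ C
    · simpa [hx] using Or.inl (hB x hx)
    · simp [hx]
  have hη' : Continuous fun x => fderiv ℝ η x (EuclideanSpace.single i 1) :=
    (hη.continuous_fderiv (by simp)).clm_apply continuous_const
  have hη'c : HasCompactSupport fun x => fderiv ℝ η x (EuclideanSpace.single i 1) :=
    hηc.fderiv_apply ℝ _
  have hsm : ∀ k, ContDiff ℝ ∞ (mollify (bumpSeq n k) (C.indicator f)) := fun k =>
    contDiff_mollify _ hfC.locallyIntegrable
  have hlhs : Tendsto (fun k => ∫ x in D, mollify (bumpSeq n k) (C.indicator f) (Φ x) *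
      fderiv ℝ η x (EuclideanSpace.single i 1)) atTop
      (𝓝 (∫ x in D, f (Φ x) * fderiv ℝ η x (EuclideanSpace.single i 1))) := by
    refine tendsto_integral_of_dominated_convergence
      (fun x => max B 0 * ‖fderiv ℝ η x (EuclideanSpace.single i 1)‖) ?_ ?_ ?_ ?_
    · intro k
      exact (((hsm k).continuous.comp_continuousOn hΦ).mul hη'.continuousOn).aestronglyMeasurable
        hD.measurableSet
    · exact ((hη'.integrable_of_hasCompactSupport hη'c).norm.const_mul _).integrableOn
    · intro k
      refine Eventually.of_forall fun x => ?_
      rw [norm_mul]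
      exact mul_le_mul_of_nonneg_right (norm_mollify_le _ hB' _) (norm_nonneg _)
    · refine Eventually.of_forall fun x => ?_
      by_cases hx : x ∈ tsupport η
      · refine Tendsto.mul_const _ ?_
        have hmem : Φ x ∈ Φ '' tsupport η := mem_image_of_mem Φ hx
        have hnhds : C ∈ 𝓝 (Φ x) :=
          mem_of_superset (ball_mem_nhds _ hr) fun y hy =>
            mem_cthickening_of_dist_le _ _ _ _ hmem (mem_ball.1 hy).le
        -- Continuity of `f` gives convergence at every point `Φ x`. Convergence a.e. in `D'` would
        -- not suffice, since preimages of null sets may have positive measure.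
        have hc : ContinuousAt (C.indicator f) (Φ x) := by
          refine ((hfc.mono hrD).continuousAt hnhds).congr ?_
          filter_upwards [hnhds] with y hy
          rw [indicator_of_mem hy]
        have := tendsto_mollify_of_continuousAt hfC.aestronglyMeasurable hc
        rwa [indicator_of_mem (hLC hmem)] at this
      · rw [fderiv_of_notMem_tsupport ℝ hx]
        simp
  refine le_of_tendsto hlhs.norm ?_
  -- One half of `r` is for the neighbourhood of the image on which the gradient is bounded, the
  -- other for the kernel radius.
  filter_upwards [eventually_bumpSeq_rOut_lt n (half_pos hr)] with k hk
  refine norm_integral_comp_mul_fderiv_le_of_contDiff hD hΦ hG hη hηc hηD i hM (half_pos hr)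
    (hsm k) fun y hy => ?_
  exact hf.norm_fderiv_mollify_le hD' hC hrD _
    (closedBall_subset_cthickening_of_mem (by linarith) hy) hM hgM

/-! ### Functionals dominated by an integral. -/

/-- Testing with translated kernels shows that the mollifications of `p` are nonnegative, and they
converge to `p` a.e. -/
theorem ae_nonneg_of_forall_integral_mul_nonneg {D : Set (EuclideanSpace ℝ (Fin n))}
    (hD : IsOpen D) {p : EuclideanSpace ℝ (Fin n) → ℝ} (hp : LocallyIntegrableOn p D)
    (h : ∀ η : EuclideanSpace ℝ (Fin n) → ℝ, ContDiff ℝ ∞ η → HasCompactSupport η →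
      tsupport η ⊆ D → (∀ x, 0 ≤ η x) → 0 ≤ ∫ x in D, p x * η x) :
    ∀ᵐ x ∂(volume.restrict D), 0 ≤ p x := by
  rw [ae_restrict_iff' hD.measurableSet, ae_iff]
  refine measure_null_of_locally_null _ fun x hx => ?_
  simp only [mem_ofPred_eq, Classical.not_imp] at hx
  obtain ⟨R, hR, hRD⟩ := Metric.nhds_basis_closedBall.mem_iff.1 (hD.mem_nhds hx.1)
  have hpC := integrable_indicator_of_isCompact hp (isCompact_closedBall x R) hRD
  refine ⟨_, inter_mem_nhdsWithin _ (ball_mem_nhds x (half_pos hR)), ?_⟩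
  have h0 := ae_tendsto_mollify hpC.locallyIntegrable
  rw [ae_iff] at h0
  refine measure_mono_null (fun y hy => ?_) h0
  simp only [mem_ofPred_eq, Classical.not_imp, mem_inter_iff] at hy ⊢
  intro hlim
  refine hy.1.2 ?_
  have hyC : y ∈ closedBall x R := ball_subset_closedBall
    (ball_subset_ball (half_le_self hR.le) hy.2)
  rw [indicator_of_mem hyC] at hlim
  refine ge_of_tendsto hlim ?_
  filter_upwards [eventually_bumpSeq_rOut_lt n (half_pos hR)] with k hk
  have hsub : closedBall y (bumpSeq n k).rOut ⊆ closedBall x R := by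
    refine closedBall_subset_closedBall' ?_
    have := mem_ball.1 hy.2
    linarith
  rw [mollify_indicator_eq_setIntegral hD hRD _ hsub]
  exact h _ (contDiff_bump_sub _ y) (hasCompactSupport_bump_sub _ y)
    ((tsupport_bump_sub_subset _ y).trans (hsub.trans hRD)) fun t => ContDiffBump.nonneg_normed _ _

/-- The space of test functions on `D`. -/
def testFunctions (D : Set (EuclideanSpace ℝ (Fin n))) :
    Submodule ℝ (EuclideanSpace ℝ (Fin n) → ℝ) where
  carrier := {η | ContDiff ℝ ∞ η ∧ HasCompactSupport η ∧ tsupport η ⊆ D}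
  add_mem' := by
    rintro a b ⟨ha1, ha2, ha3⟩ ⟨hb1, hb2, hb3⟩
    exact ⟨ha1.add hb1, ha2.add hb2, (tsupport_add a b).trans (union_subset ha3 hb3)⟩
  zero_mem' := by
    refine ⟨contDiff_const, HasCompactSupport.zero, ?_⟩
    simp [tsupport]
  smul_mem' := by
    rintro c a ⟨ha1, ha2, ha3⟩
    exact ⟨contDiff_const.smul ha1, ha2.smul_left (f := fun _ => c),
      (tsupport_smul_subset_right (fun _ => c) a).trans ha3⟩

theorem integrableOn_mul_of_locallyIntegrableOn {D : Set (EuclideanSpace ℝ (Fin n))}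
    {u ψ : EuclideanSpace ℝ (Fin n) → ℝ} (hu : LocallyIntegrableOn u D) (hψ : Continuous ψ)
    (hψc : HasCompactSupport ψ) (hψD : tsupport ψ ⊆ D) : IntegrableOn (fun x => u x * ψ x) D := by
  have h1 : IntegrableOn u (tsupport ψ) := hu.integrableOn_compact_subset hψD hψc
  have h2 : IntegrableOn (fun x => u x * ψ x) (tsupport ψ) :=
    h1.mul_continuousOn hψ.continuousOn hψc
  refine Integrable.integrableOn ((integrableOn_iff_integrable_of_support_subset ?_).1 h2)
  exact fun x hx => subset_tsupport _ fun h0 => hx (by simp [h0])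

/-- A linear functional on test functions dominated by integration against `G` is given by
integration against a function dominated by `G`. -/
theorem exists_integral_representation {D : Set (EuclideanSpace ℝ (Fin n))}
    (hD : IsOpen D) {G w : EuclideanSpace ℝ (Fin n) → ℝ} (hG : ∀ x, 0 ≤ G x)
    (hw : ∀ x, 0 < w x) (hwc : Continuous w) (hGw : IntegrableOn (fun x => G x * w x) D)
    (ℓ : testFunctions D →ₗ[ℝ] ℝ)
    (hℓ : ∀ η : testFunctions D, ‖ℓ η‖ ≤ ∫ x in D, G x * ‖η.1 x‖) :
    ∃ v : EuclideanSpace ℝ (Fin n) → ℝ, LocallyIntegrableOn v D ∧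
      (∀ᵐ x ∂(volume.restrict D), ‖v x‖ ≤ G x) ∧
      ∀ η : testFunctions D, ℓ η = ∫ x in D, v x * η.1 x := by
  have hwi : Continuous fun x => (w x)⁻¹ := hwc.inv₀ fun x => (hw x).ne'
  have hGw0 : ∀ x, 0 ≤ G x * w x := fun x => mul_nonneg (hG x) (hw x).le
  have hdm : AEMeasurable (fun x => ENNReal.ofReal (G x * w x)) (volume.restrict D) :=
    hGw.aestronglyMeasurable.aemeasurable.ennreal_ofReal
  -- The weight makes `ν = G w dx` finite. Under `η ↦ η / w` the bound `∫ G |η|` becomes the `L¹(ν)`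
  -- norm, which the `L²(ν)` norm controls, so Hilbert space duality can be used.
  set ν : Measure (EuclideanSpace ℝ (Fin n)) :=
    (volume.restrict D).withDensity fun x => ENNReal.ofReal (G x * w x) with hν
  have hfin : IsFiniteMeasure ν := isFiniteMeasure_withDensity_ofReal hGw.2
  have hνint : ∀ f : EuclideanSpace ℝ (Fin n) → ℝ,
      ∫ x, f x ∂ν = ∫ x in D, (G x * w x) * f x := by
    intro f
    rw [hν, integral_withDensity_eq_integral_toReal_smul₀ hdm
      (Eventually.of_forall fun _ => ENNReal.ofReal_lt_top)]
    simp only [ENNReal.toReal_ofReal (hGw0 _), smul_eq_mul]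
  have hmem : ∀ η : testFunctions D, MemLp (fun x => η.1 x * (w x)⁻¹) 2 ν := by
    intro η
    have hc : Continuous fun x => η.1 x * (w x)⁻¹ := η.2.1.continuous.mul hwi
    obtain ⟨B, hB⟩ := (η.2.2.1.mul_right (f' := fun x => (w x)⁻¹)).exists_bound_of_continuous hc
    exact MemLp.of_bound hc.aestronglyMeasurable B (Eventually.of_forall hB)
  let e : testFunctions D →ₗ[ℝ] Lp ℝ 2 ν :=
    { toFun := fun η => (hmem η).toLp _
      map_add' := fun a b => by
        rw [← MemLp.toLp_add]
        congr 1
        ext x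
        simp [add_mul]
      map_smul' := fun c a => by
        rw [RingHom.id_apply, ← MemLp.toLp_const_smul]
        congr 1
        ext x
        simp [mul_assoc] }
  have he : ∀ η, (e η : EuclideanSpace ℝ (Fin n) → ℝ) =ᵐ[ν] fun x => η.1 x * (w x)⁻¹ :=
    fun η => (hmem η).coeFn_toLp
  obtain ⟨A, hA⟩ : ∃ A : ℝ, ∀ η, ‖ℓ η‖ ≤ A * ‖e η‖ := by
    -- The Hölder constant `ν(univ)^(1 - 1/2)` of the inclusion of `L²(ν)` in `L¹(ν)`.
    refine ⟨((ν univ) ^ (1 / (1 : ℝ≥0∞).toReal - 1 / (2 : ℝ≥0∞).toReal)).toReal, fun η => ?_⟩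
    have h1 : ∫ x in D, G x * ‖η.1 x‖ = ∫ x, ‖η.1 x * (w x)⁻¹‖ ∂ν := by
      rw [hνint]
      refine integral_congr_ae (Eventually.of_forall fun x => ?_)
      have := (hw x).ne'
      simp only [norm_mul, norm_inv, Real.norm_of_nonneg (hw x).le]
      field_simp
    have h2 := eLpNorm_le_eLpNorm_mul_rpow_measure_univ (p := 1) (q := 2) one_le_two
      (hmem η).aestronglyMeasurable
    have hexp : (0 : ℝ) ≤ 1 / (1 : ℝ≥0∞).toReal - 1 / (2 : ℝ≥0∞).toReal := by norm_num
    have h3 : (ν univ) ^ (1 / (1 : ℝ≥0∞).toReal - 1 / (2 : ℝ≥0∞).toReal) ≠ ⊤ :=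
      ENNReal.rpow_ne_top_of_nonneg hexp (measure_ne_top _ _)
    refine (hℓ η).trans ?_
    rw [h1, integral_norm_eq_lintegral_enorm (hmem η).aestronglyMeasurable,
      ← eLpNorm_one_eq_lintegral_enorm, mul_comm]
    refine (ENNReal.toReal_mono (ENNReal.mul_ne_top (hmem η).eLpNorm_ne_top h3) h2).trans_eq ?_
    rw [ENNReal.toReal_mul, show e η = (hmem η).toLp _ from rfl, Lp.norm_toLp]
  -- The bound `hA` makes `ℓ` factor through the range of `e`, even if `e` is not injective;
  -- Hahn–Banach then extends it to `L²(ν)`.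
  obtain ⟨T, hT, -⟩ := exists_extension_norm_eq (LinearMap.range e) (ℓ.compLeftInverse e)
  set h : Lp ℝ 2 ν := (InnerProductSpace.toDual ℝ (Lp ℝ 2 ν)).symm T
  -- In `∫ h (η / w) dν` the weight cancels, so the representing function is `G h`.
  have hrep : ∀ η, ℓ η = ∫ x in D, (G x * h x) * η.1 x := by
    intro η
    have h1 : T (e η) = ℓ η := by
      rw [hT ⟨e η, LinearMap.mem_range_self e η⟩]
      exact LinearMap.compLeftInverse_apply_of_bdd _ _ ⟨A, hA⟩ _ _ rfl
    rw [← h1, ← InnerProductSpace.toDual_symm_apply (𝕜 := ℝ) (y := T), L2.inner_def]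
    have h2 : ∫ x, inner ℝ (h x) (e η x) ∂ν = ∫ x, h x * (η.1 x * (w x)⁻¹) ∂ν := by
      refine integral_congr_ae ?_
      filter_upwards [he η] with x hx
      rw [hx]
      simp [mul_comm]
    rw [h2, hνint]
    refine integral_congr_ae (Eventually.of_forall fun x => ?_)
    have := (hw x).ne'
    field_simp
  have hdiv : ∀ p : EuclideanSpace ℝ (Fin n) → ℝ, IntegrableOn (fun x => (G x * w x) * p x) D →
      LocallyIntegrableOn (fun x => G x * p x) D := by
    intro p hp
    have := hp.locallyIntegrableOn.mul_continuousOn hwi.continuousOn hD.isLocallyClosed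
    convert this using 2 with x
    have := (hw x).ne'
    field_simp
  have hGl : LocallyIntegrableOn G D := by
    simpa using hdiv (fun _ => 1) (by simpa using hGw)
  have hvl : LocallyIntegrableOn (fun x => G x * h x) D := by
    refine hdiv h ?_
    have h1 : Integrable h ν := (Lp.memLp h).integrable one_le_two
    have h2 := (integrable_withDensity_iff_integrable_smul₀' hdm
      (Eventually.of_forall fun _ => ENNReal.ofReal_lt_top)).1 h1
    simp only [ENNReal.toReal_ofReal (hGw0 _), smul_eq_mul] at h2
    exact h2
  have hint : ∀ {p}, LocallyIntegrableOn p D → ∀ η : testFunctions D,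
      IntegrableOn (fun x => p x * η.1 x) D := fun hp η =>
    integrableOn_mul_of_locallyIntegrableOn hp η.2.1.continuous η.2.2.1 η.2.2.2
  have hle : ∀ η : testFunctions D, (∀ x, 0 ≤ η.1 x) →
      |∫ x in D, (G x * h x) * η.1 x| ≤ ∫ x in D, G x * η.1 x := by
    intro η hη
    rw [← hrep]
    refine (hℓ η).trans_eq ?_
    simp only [Real.norm_of_nonneg (hη _)]
  refine ⟨_, hvl, ?_, hrep⟩
  -- The `L²` argument loses the sharp bound. It is recovered by testing `G - G h` and `G + G h`
  -- against nonnegative `η`.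
  have hup := ae_nonneg_of_forall_integral_mul_nonneg hD (hGl.sub hvl) fun η h1 h2 h3 h4 => by
    have := (abs_le.1 (hle ⟨η, h1, h2, h3⟩ h4)).2
    have e1 : ∫ x in D, (G - fun x => G x * h x) x * η x =
        (∫ x in D, G x * η x) - ∫ x in D, (G x * h x) * η x := by
      rw [← integral_sub (hint hGl ⟨η, h1, h2, h3⟩) (hint hvl ⟨η, h1, h2, h3⟩)]
      simp only [Pi.sub_apply, sub_mul]
    rw [e1]
    exact sub_nonneg.2 this
  have hlo := ae_nonneg_of_forall_integral_mul_nonneg hD (hGl.add hvl) fun η h1 h2 h3 h4 => by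
    have := (abs_le.1 (hle ⟨η, h1, h2, h3⟩ h4)).1
    have e1 : ∫ x in D, (G + fun x => G x * h x) x * η x =
        (∫ x in D, G x * η x) + ∫ x in D, (G x * h x) * η x := by
      rw [← integral_add (hint hGl ⟨η, h1, h2, h3⟩) (hint hvl ⟨η, h1, h2, h3⟩)]
      simp only [Pi.add_apply, add_mul]
    rw [e1]
    simp only at this
    linarith
  filter_upwards [hup, hlo] with x hx1 hx2
  simp only [Pi.sub_apply, Pi.add_apply] at hx1 hx2
  rw [Real.norm_eq_abs, abs_le]
  constructor <;> linarith

/-- Supplies the weight for the representation: `|G| ≤ 1 + |G|^q` and the weight is at most 1, while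
its exponent `n + 1` exceeds the dimension and makes it integrable. -/
theorem integrableOn_mul_one_add_norm {D : Set (EuclideanSpace ℝ (Fin n))}
    {G : EuclideanSpace ℝ (Fin n) → ℝ} {q : ℝ≥0∞} (hq : 1 ≤ q) (hq' : q ≠ ⊤)
    (hG : MemLp G q (volume.restrict D)) :
    IntegrableOn (fun x => G x * (1 + ‖x‖) ^ (-((n : ℝ) + 1))) D := by
  have hw : Integrable fun x : EuclideanSpace ℝ (Fin n) => (1 + ‖x‖) ^ (-((n : ℝ) + 1)) :=
    integrable_one_add_norm (by simp)
  have hGq := hG.integrable_norm_rpow (zero_lt_one.trans_le hq).ne' hq'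
  refine Integrable.mono' (hw.integrableOn.add hGq)
    (hG.aestronglyMeasurable.mul hw.aestronglyMeasurable.restrict) ?_
  refine Eventually.of_forall fun x => ?_
  have hb : (1 : ℝ) ≤ 1 + ‖x‖ := by linarith [norm_nonneg x]
  have h0 : 0 ≤ (1 + ‖x‖) ^ (-((n : ℝ) + 1)) := by positivity
  have h1 : (1 + ‖x‖) ^ (-((n : ℝ) + 1)) ≤ 1 :=
    Real.rpow_le_one_of_one_le_of_nonpos hb (by linarith [n.cast_nonneg (α := ℝ)])
  have hq1 : 1 ≤ q.toReal := by
    rw [← ENNReal.toReal_one]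
    exact ENNReal.toReal_mono hq' hq
  rw [norm_mul, Real.norm_of_nonneg h0, Pi.add_apply]
  have h3 : 0 ≤ ‖G x‖ ^ q.toReal := by positivity
  rcases le_total ‖G x‖ 1 with h | h
  · nlinarith
  · have h2 : ‖G x‖ ≤ ‖G x‖ ^ q.toReal := Real.self_le_rpow_of_one_le h hq1
    nlinarith [norm_nonneg (G x)]

/-- A function whose distributional derivatives are dominated by `G ∈ L_q` is weakly differentiable,
and its weak gradient is controlled by `G`. -/
theorem exists_hasWeakGradient_of_norm_integral_le {D : Set (EuclideanSpace ℝ (Fin n))}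
    (hD : IsOpen D) {u G : EuclideanSpace ℝ (Fin n) → ℝ} (hu : LocallyIntegrableOn u D)
    (hG0 : ∀ x, 0 ≤ G x) {q : ℝ≥0∞} (hq : 1 ≤ q) (hq' : q ≠ ⊤)
    (hG : MemLp G q (volume.restrict D))
    (hb : ∀ η : EuclideanSpace ℝ (Fin n) → ℝ, ContDiff ℝ ∞ η → HasCompactSupport η →
      tsupport η ⊆ D → ∀ i : Fin n,
      ‖∫ x in D, u x * fderiv ℝ η x (EuclideanSpace.single i 1)‖ ≤ ∫ x in D, G x * ‖η x‖) :
    ∃ v, HasWeakGradient D u v ∧ ∀ᵐ x ∂(volume.restrict D), ‖v x‖ ≤ n * G x := by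
  have hui : ∀ (η : testFunctions D) (i : Fin n),
      IntegrableOn (fun x => u x * fderiv ℝ η.1 x (EuclideanSpace.single i 1)) D := fun η i =>
    integrableOn_mul_of_locallyIntegrableOn hu
      ((η.2.1.continuous_fderiv (by simp)).clm_apply continuous_const)
      (η.2.2.1.fderiv_apply ℝ _) ((tsupport_fderiv_apply_subset ℝ _).trans η.2.2.2)
  have hdiff : ∀ (η : testFunctions D) (x : EuclideanSpace ℝ (Fin n)),
      DifferentiableAt ℝ η.1 x := fun η => η.2.1.differentiable (by simp)
  let ℓ : Fin n → testFunctions D →ₗ[ℝ] ℝ := fun i =>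
    { toFun := fun η => - ∫ x in D, u x * fderiv ℝ η.1 x (EuclideanSpace.single i 1)
      map_add' := fun a b => by
        rw [← neg_add, ← integral_add (hui a i) (hui b i)]
        congr 2
        ext x
        rw [Submodule.coe_add, fderiv_add (hdiff a x) (hdiff b x), add_apply, mul_add]
      map_smul' := fun c a => by
        rw [RingHom.id_apply, smul_eq_mul, mul_neg, ← integral_const_mul]
        congr 2
        ext x
        rw [Submodule.coe_smul, fderiv_const_smul (hdiff a x), smul_apply, smul_eq_mul]
        ring }
  have hrep := fun i => exists_integral_representation hD hG0
    (w := fun x => (1 + ‖x‖) ^ (-((n : ℝ) + 1))) (fun x => by positivity)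
    (Continuous.rpow_const (by fun_prop) fun x => Or.inl (by positivity))
    (integrableOn_mul_one_add_norm hq hq' hG) (ℓ i)
    (fun η => by
      rw [← norm_neg]
      simpa [ℓ] using hb η.1 η.2.1 η.2.2.1 η.2.2.2 i)
  choose v hv hvG hvℓ using hrep
  refine ⟨fun x => WithLp.toLp 2 fun i => v i x, ⟨hu, ?_, ?_⟩, ?_⟩
  · have e : (fun x => WithLp.toLp 2 fun i => v i x) =
        fun x => ∑ i, v i x • EuclideanSpace.single i (1 : ℝ) := by
      ext x j
      simp [Finset.sum_apply, Pi.single_apply]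
    rw [e, locallyIntegrableOn_iff hD.isLocallyClosed]
    intro k hkD hk
    exact integrable_finsetSum _ fun i _ =>
      ((hv i).integrableOn_compact_subset hkD hk).smul_const _
  · intro η h1 h2 h3 i
    have := hvℓ i ⟨η, h1, h2, h3⟩
    simp only [ℓ, LinearMap.coe_mk, AddHom.coe_mk] at this
    rw [← this, neg_neg]
  · filter_upwards [ae_all_iff.2 hvG] with x hx
    -- Each of the `n` components is bounded by `G`, whence the factor `n`.
    refine (EuclideanSpace.norm_le_sum_norm _).trans ?_
    refine (Finset.sum_le_sum fun i _ => hx i).trans_eq ?_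
    simp

/-! ### Seminorms and the two implications. -/

theorem WeaklyDifferentiable.hasWeakGradient {D : Set (EuclideanSpace ℝ (Fin n))}
    {f : EuclideanSpace ℝ (Fin n) → ℝ} (h : WeaklyDifferentiable D f) :
    HasWeakGradient D f (weakGradient D f) := by
  rw [weakGradient, dif_pos h]
  exact h.choose_spec

theorem HasWeakGradient.sobolevSeminorm_eq {D : Set (EuclideanSpace ℝ (Fin n))} (hD : IsOpen D)
    {f : EuclideanSpace ℝ (Fin n) → ℝ} {g : EuclideanSpace ℝ (Fin n) → EuclideanSpace ℝ (Fin n)}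
    (h : HasWeakGradient D f g) (p : ℝ≥0∞) :
    sobolevSeminorm p D f = eLpNorm g p (volume.restrict D) :=
  eLpNorm_congr_ae (HasWeakGradient.ae_eq hD (WeaklyDifferentiable.hasWeakGradient ⟨g, h⟩) h)

theorem MemSobolev1.memLp_weakGradient {D : Set (EuclideanSpace ℝ (Fin n))}
    {f : EuclideanSpace ℝ (Fin n) → ℝ} {p : ℝ≥0∞} (h : MemSobolev1 p D f) :
    MemLp (weakGradient D f) p (volume.restrict D) :=
  ⟨h.1.hasWeakGradient.locallyIntegrableOn_grad.aestronglyMeasurable, h.2⟩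

theorem hasWeakGradient_coord {D : Set (EuclideanSpace ℝ (Fin n))} (hD : IsOpen D) (j : Fin n) :
    HasWeakGradient D (fun y => y j) fun _ => EuclideanSpace.single j 1 where
  locallyIntegrableOn := ContinuousOn.locallyIntegrableOn
    (EuclideanSpace.proj (𝕜 := ℝ) j).continuous.continuousOn hD.measurableSet
  locallyIntegrableOn_grad := continuousOn_const.locallyIntegrableOn hD.measurableSet
  integral_eq η h1 h2 h3 i := by
    rw [setIntegral_mul_fderiv_eq h3, setIntegral_mul_eq h3 fun _ => EuclideanSpace.single j 1 i]
    have hc : Continuous fun y : EuclideanSpace ℝ (Fin n) => y j :=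
      (EuclideanSpace.proj (𝕜 := ℝ) j).continuous
    have hd : ∀ x, fderiv ℝ (fun y : EuclideanSpace ℝ (Fin n) => y j) x
        (EuclideanSpace.single i 1) = EuclideanSpace.single j (1 : ℝ) i := by
      intro x
      have : fderiv ℝ (fun y : EuclideanSpace ℝ (Fin n) => y j) x = EuclideanSpace.proj j :=
        (EuclideanSpace.proj (𝕜 := ℝ) j).fderiv
      rw [this]
      simp [eq_comm]
    have e : ∫ x, EuclideanSpace.single j (1 : ℝ) i * η x =
        ∫ x, fderiv ℝ (fun y : EuclideanSpace ℝ (Fin n) => y j) x (EuclideanSpace.single i 1) *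
          η x := integral_congr_ae (Eventually.of_forall fun x => by simp only [hd])
    rw [e]
    refine integral_mul_fderiv_eq_neg_fderiv_mul_of_integrable ?_ ?_ ?_ ?_ ?_
    · simp_rw [hd]
      exact (h1.continuous.integrable_of_hasCompactSupport h2).const_mul _
    · exact (hc.mul ((h1.continuous_fderiv (by simp)).clm_apply continuous_const))
        |>.integrable_of_hasCompactSupport (h2.fderiv_apply ℝ _).mul_left
    · exact (hc.mul h1.continuous).integrable_of_hasCompactSupport h2.mul_left
    · exact fun x _ => (EuclideanSpace.proj (𝕜 := ℝ) j).differentiableAt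
    · exact fun x _ => h1.differentiable (by simp) x

theorem MapMemSobolev1.generatesBoundedComposition {D D' : Set (EuclideanSpace ℝ (Fin n))}
    (hD : IsOpen D) (hD' : IsOpen D') {φ : EuclideanSpace ℝ (Fin n) → EuclideanSpace ℝ (Fin n)}
    (hφ : ContinuousOn φ D) (hmaps : MapsTo φ D D') {q : ℝ≥0∞} (hq : 1 ≤ q) (hq' : q ≠ ⊤)
    (h : MapMemSobolev1 q D φ) : GeneratesBoundedComposition ⊤ q D D' φ := by
  -- The factor `n` comes from summing the components of the gradient, the sum over `j` from the
  -- bound `M ∑ⱼ |∇φⱼ|` and Minkowski's inequality.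
  refine ⟨n * ∑ j, (sobolevSeminorm q D fun x => φ x j).toNNReal, fun f hf => ?_⟩
  set M : ℝ≥0 := (sobolevSeminorm ⊤ D' f).toNNReal
  have hMtop : (M : ℝ≥0∞) = sobolevSeminorm ⊤ D' f := ENNReal.coe_toNNReal hf.2.ne
  have hg := hf.1.hasWeakGradient
  have hgM : ∀ᵐ y ∂(volume.restrict D'), ‖weakGradient D' f y‖ ≤ M := by
    have h1 : ∀ᵐ y ∂(volume.restrict D'),
        ‖weakGradient D' f y‖ₑ ≤ eLpNormEssSup (weakGradient D' f) (volume.restrict D') :=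
      enorm_ae_le_eLpNormEssSup _ _
    filter_upwards [h1] with y hy
    rw [← eLpNorm_exponent_top] at hy
    have h2 : ‖weakGradient D' f y‖ₑ ≤ (M : ℝ≥0∞) := hy.trans_eq hMtop.symm
    rw [enorm_eq_nnnorm, ENNReal.coe_le_coe] at h2
    exact h2
  set F := lebesgueModification f
  have hF : HasWeakGradient D' F (weakGradient D' f) :=
    hg.congr_ae (hg.ae_eq_lebesgueModification hD' hgM)
  have hFc : ContinuousOn F D' := hg.continuousOn_lebesgueModification hD' hgM
  set G : Fin n → EuclideanSpace ℝ (Fin n) → EuclideanSpace ℝ (Fin n) :=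
    fun j => weakGradient D fun x => φ x j
  have hGw : ∀ j, HasWeakGradient D (fun x => φ x j) (G j) := fun j => (h j).1.hasWeakGradient
  have hGq : ∀ j, MemLp (G j) q (volume.restrict D) := fun j => (h j).memLp_weakGradient
  have hSq : MemLp (fun x => ∑ j, ‖G j x‖) q (volume.restrict D) :=
    memLp_finsetSum _ fun j _ => (hGq j).norm
  have hu : LocallyIntegrableOn (F ∘ φ) D :=
    (hFc.comp hφ hmaps).locallyIntegrableOn hD.measurableSet
  obtain ⟨v, hv, hvG⟩ := exists_hasWeakGradient_of_norm_integral_le hD hu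
    (G := fun x => M * ∑ j, ‖G j x‖) (fun x => by positivity) hq hq' (hSq.const_mul _)
    (fun η h1 h2 h3 i => by
      refine (hF.norm_integral_comp_mul_fderiv_le hD hD' hφ hmaps hGw hFc M.2 hgM h1 h2 h3
        i).trans_eq ?_
      rw [← integral_finsetSum, ← integral_const_mul]
      · refine integral_congr_ae (Eventually.of_forall fun x => ?_)
        simp only [Finset.sum_mul, mul_assoc]
        rfl
      · intro j _
        have := integrableOn_mul_of_locallyIntegrableOn (hGw j).locallyIntegrableOn_grad.norm
          h1.continuous.norm h2.norm
          ((tsupport_comp_subset norm_zero η).trans h3)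
        exact this)
  have hle : sobolevSeminorm q D (F ∘ φ) ≤
      ((n * ∑ j, (sobolevSeminorm q D fun x => φ x j).toNNReal : ℝ≥0) : ℝ≥0∞) *
        sobolevSeminorm ⊤ D' f := by
    have e1 : eLpNorm v q (volume.restrict D) ≤
        eLpNorm (fun x => (n * M : ℝ) • ∑ j, ‖G j x‖) q (volume.restrict D) := by
      refine eLpNorm_mono_ae ?_
      filter_upwards [hvG] with x hx
      rw [Real.norm_of_nonneg (by positivity), smul_eq_mul, mul_assoc]
      exact hx
    rw [hv.sobolevSeminorm_eq hD]
    refine e1.trans ?_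
    have e2 : eLpNorm (fun x => ∑ j, ‖G j x‖) q (volume.restrict D) ≤
        ∑ j, sobolevSeminorm q D fun x => φ x j := by
      have := eLpNorm_sum_le (s := Finset.univ) (f := fun j x => ‖G j x‖)
        (fun j _ => (hGq j).norm.aestronglyMeasurable) hq
      simp only [eLpNorm_norm] at this
      refine le_trans (le_of_eq ?_) this
      congr 1
      ext x
      simp
    have e3 := eLpNorm_const_smul (n * M : ℝ) (fun x => ∑ j, ‖G j x‖) q (volume.restrict D)
    have e4 : ‖(n * M : ℝ)‖ₑ = n * (M : ℝ≥0∞) := by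
      have : (n * M : ℝ) = ((n * M : ℝ≥0) : ℝ) := by push_cast; rfl
      rw [this, enorm_eq_nnnorm, Real.nnnorm_of_nonneg (NNReal.coe_nonneg _)]
      push_cast
      rfl
    refine (e3.trans_le (mul_le_mul_right e2 _)).trans_eq ?_
    rw [e4, hMtop]
    push_cast
    rw [Finset.sum_congr rfl fun j _ => ENNReal.coe_toNNReal (h j).2.ne]
    ring
  refine ⟨⟨⟨v, hv⟩, hle.trans_lt ?_⟩, hle⟩
  exact ENNReal.mul_lt_top ENNReal.coe_lt_top hf.2

/-- It suffices to apply the operator to the coordinate functions, which are continuous and hence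
unchanged by the modification. -/
theorem GeneratesBoundedComposition.mapMemSobolev1 {D D' : Set (EuclideanSpace ℝ (Fin n))}
    (hD' : IsOpen D') {φ : EuclideanSpace ℝ (Fin n) → EuclideanSpace ℝ (Fin n)} {q : ℝ≥0∞}
    (h : GeneratesBoundedComposition ⊤ q D D' φ) : MapMemSobolev1 q D φ := by
  obtain ⟨K, hK⟩ := h
  intro j
  have hw := hasWeakGradient_coord hD' j
  have hmem : MemSobolev1 ⊤ D' fun y => y j := by
    refine ⟨⟨_, hw⟩, ?_⟩
    rw [hw.sobolevSeminorm_eq hD']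
    exact (memLp_top_const _).2
  have h1 := (hK _ hmem).1
  have hc : Continuous fun y : EuclideanSpace ℝ (Fin n) => y j :=
    (EuclideanSpace.proj (𝕜 := ℝ) j).continuous
  rwa [lebesgueModification_of_continuous hc] at h1

theorem theorem2 {n : ℕ} (D D' : Set (EuclideanSpace ℝ (Fin n)))
    (hD : IsOpen D) (hDc : IsConnected D) (hD' : IsOpen D') (hDc' : IsConnected D')
    (φ : OpenPartialHomeomorph (EuclideanSpace ℝ (Fin n)) (EuclideanSpace ℝ (Fin n)))
    (hsource : φ.source = D) (htarget : φ.target = D')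
    (q : ℝ≥0∞) (hq : 1 < q) (hq' : q < ⊤) :
    GeneratesBoundedComposition ⊤ q D D' φ ↔ MapMemSobolev1 q D φ := by
  subst hsource htarget
  exact ⟨fun h => h.mapMemSobolev1 hD', fun h => h.generatesBoundedComposition hD hD'
    φ.continuousOn φ.mapsTo hq.le hq'.ne⟩
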